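/- For a unitary $U\in U(2)$ let $\hat U=\begin{pmatrix}1&0&0\\0&U&0\\0&0&1\end{pmatrix}$ be the two-qubit gate that fixes $|00\rangle$ and $|11\rangle$ and acts as $U$ on the span of $|01\rangle,|10\rangle$ (in this order). Let Fredkin be the controlled-SWAP gate, and for real $\delta$ let $E_\delta=\begin{pmatrix}1&0\\0&e^{i\delta}\end{pmatrix}$. An operator on $(\mathbb C^2)^{\otimes n}$ is weight-preserving if it maps each computational basis state of Hamming weight $k$ into the span of the basis states of weight $k$, for every $k$. Circuits over a gate set are finite products of gates of the set, each applied to arbitrary distinct qubits in any order. **Lemma.** Let $U_1,\dots,U_s$ be single-qubit gates such that $\{U_1,\dots,U_s,\mathrm{CNOT}\}$ is universal in the standard sense: for every $n$, every unitary on $n$ qubits can be approximated to arbitrary accuracy in operator norm, up to a global phase, by $n$-qubit circuits over this set. Then, for every fixed real $\delta$, the set $\mathcal G=\{\hat U_1,\dots,\hat U_s,\mathrm{Fredkin},E_\delta\}$ is weight-universal with two ancilla qubits in the state $|01\rangle$: all gates in $\mathcal G$ are weight-preserving, and for every $n$, every weight-preserving unitary $V$ on $n$ qubits and every $\varepsilon>0$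 there is a circuit $C$ over $\mathcal G$ on $n+2$ qubits such that for all $|\psi\rangle\in(\mathbb C^2)^{\otimes n}$ $$\bigl\|C\,(|\psi\rangle\otimes|01\rangle)-(V|\psi\rangle)\otimes|01\rangle\bigr\|\le\varepsilon\,\||\psi\rangle\|.$$ -/

import Mathlib

noncomputable section

namespace WeightCircuit

/-- Labels of the computational basis states of `n` qubits. -/
abbrev Bits (n : ℕ) : Type := Fin n → Fin 2

/-- The state space `(ℂ²)^{⊗ n}` with its standard inner product, in the computational basis. -/
abbrev State (n : ℕ) : Type := EuclideanSpace ℂ (Bits n)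

/-- Operators on `n` qubits, as matrices in the computational basis. -/
abbrev Op (n : ℕ) : Type := Matrix (Bits n) (Bits n) ℂ

/-- The Hamming weight of a basis label. -/
def weight {n : ℕ} (x : Bits n) : ℕ := (Finset.univ.filter fun i => x i = 1).card

/-- `O` is weight-preserving: for every basis state `|x⟩` of weight `k`, the vector `O|x⟩` is a
combination of basis states of weight exactly `k`. -/
def IsWeightPreserving {n : ℕ} (O : Op n) : Prop :=
  ∀ (k : ℕ) (x : Bits n), weight x = k → ∀ y : Bits n, O y x ≠ 0 → weight y = k

/-- A quantum gate: a unitary operator on some number of qubits. -/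
structure Gate where
  arity : ℕ
  op : Op arity
  unitary : op ∈ Matrix.unitaryGroup (Bits arity) ℂ

/-- The gate `g` applied to the qubits `e 0, e 1, …` (distinct, in this order) of an `n`-qubit
register, and the identity on the other qubits. -/
def Gate.on (g : Gate) {n : ℕ} (e : Fin g.arity ↪ Fin n) : Op n :=
  Matrix.of fun y x =>
    if ∀ j, (∀ i, e i ≠ j) → y j = x j then g.op (fun i => y (e i)) (fun i => x (e i)) else 0

/-- The operators of all finite circuits on `n` qubits with gates from `G`: all finite products
of gates from `G`, each applied to any choice of distinct qubits. -/
def circuits (G : Set Gate) (n : ℕ) : Submonoid (Op n) :=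
  Submonoid.closure {A | ∃ g ∈ G, ∃ e : Fin g.arity ↪ Fin n, A = g.on e}

/-- Standard universality: on every number of qubits, every unitary is approximated to arbitrary
accuracy in operator norm, up to a global phase `c`, by circuits over `G`. -/
def IsUniversal (G : Set Gate) : Prop :=
  ∀ (n : ℕ), ∀ V ∈ Matrix.unitaryGroup (Bits n) ℂ, ∀ ε : ℝ, 0 < ε →
    ∃ C ∈ circuits G n, ∃ c : ℂ, ‖c‖ = 1 ∧
      ∀ ψ : State n, ‖Matrix.toEuclideanLin C ψ - c • Matrix.toEuclideanLin V ψ‖ ≤ ε * ‖ψ‖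

/-- The state `|ψ⟩ ⊗ |a⟩`: the register `ψ` followed by `m` ancillas in the basis state `a`. -/
def withAncilla {n m : ℕ} (a : Bits m) (ψ : State n) : State (n + m) :=
  WithLp.toLp 2 fun y =>
    if (fun j => y (Fin.natAdd n j)) = a then ψ (fun i => y (Fin.castAdd m i)) else 0

/-- Weight-universality with `m` ancillas in the basis state `a`: all gates in `G` are
weight-preserving, and on every number `n` of qubits every weight-preserving unitary `V` is
approximated to arbitrary accuracy by circuits over `G` on `n + m` qubits which map
`|ψ⟩|a⟩` to `(V|ψ⟩)|a⟩`, up to the error. -/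
def IsWeightUniversal (G : Set Gate) {m : ℕ} (a : Bits m) : Prop :=
  (∀ g ∈ G, IsWeightPreserving g.op) ∧
  ∀ (n : ℕ), ∀ V ∈ Matrix.unitaryGroup (Bits n) ℂ, IsWeightPreserving V →
    ∀ ε : ℝ, 0 < ε → ∃ C ∈ circuits G (n + m), ∀ ψ : State n,
      ‖Matrix.toEuclideanLin C (withAncilla a ψ) -
        withAncilla a (Matrix.toEuclideanLin V ψ)‖ ≤ ε * ‖ψ‖

/-- A unitary `2 × 2` matrix as a single-qubit gate. -/
def single (U : Matrix.unitaryGroup (Fin 2) ℂ) : Gate where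
  arity := 1
  op := Matrix.of fun y x => (U : Matrix (Fin 2) (Fin 2) ℂ) (y 0) (x 0)
  unitary := by
    rw [Matrix.mem_unitaryGroup_iff]
    ext y z
    have h := congrFun (congrFun (Matrix.mem_unitaryGroup_iff.1 U.2) (y 0)) (z 0)
    have hyz : y = z ↔ y 0 = z 0 :=
      ⟨fun h => h ▸ rfl, fun h => funext fun i => by rw [Subsingleton.elim i 0]; exact h⟩
    rw [Matrix.mul_apply] at h ⊢
    rw [← (Equiv.funUnique (Fin 1) (Fin 2)).symm.sum_comp]
    simpa [Matrix.one_apply, hyz, Matrix.star_apply] using h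

/-- The matrix of `Û`: the identity on `|00⟩` and `|11⟩`, and `U` on the span of `|01⟩, |10⟩`,
with `|01⟩` as the first and `|10⟩` as the second basis vector. -/
def hatOp (U : Matrix (Fin 2) (Fin 2) ℂ) : Op 2 :=
  Matrix.of fun y x =>
    if y 0 ≠ y 1 ∧ x 0 ≠ x 1 then U (y 0) (x 0) else if y = x then 1 else 0

/-- The weight-preserving two-qubit gate `Û = diag(1, U, 1)`. -/
def hat (U : Matrix.unitaryGroup (Fin 2) ℂ) : Gate where
  arity := 2
  op := hatOp U
  unitary := by
    rw [Matrix.mem_unitaryGroup_iff]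
    have h := Matrix.mem_unitaryGroup_iff.1 U.2
    have h00 := congrFun (congrFun h 0) 0
    have h01 := congrFun (congrFun h 0) 1
    have h10 := congrFun (congrFun h 1) 0
    have h11 := congrFun (congrFun h 1) 1
    simp only [Matrix.mul_apply, Fin.sum_univ_two, Matrix.star_apply, Matrix.one_apply] at *
    ext y z
    rw [Matrix.mul_apply, ← (finTwoArrowEquiv (Fin 2)).symm.sum_comp]
    obtain ⟨⟨a, b⟩, rfl⟩ := (finTwoArrowEquiv (Fin 2)).symm.surjective y
    obtain ⟨⟨c, d⟩, rfl⟩ := (finTwoArrowEquiv (Fin 2)).symm.surjective z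
    fin_cases a <;> fin_cases b <;> fin_cases c <;> fin_cases d <;>
      simp_all [hatOp, Fintype.sum_prod_type, Matrix.star_apply,
        funext_iff, Fin.forall_fin_two]

/-- The gate `|x⟩ ↦ |f x⟩` for an involution `f` of the basis labels. -/
def ofInvolution {n : ℕ} (f : Bits n → Bits n) (hf : Function.Involutive f) : Gate where
  arity := n
  op := Matrix.of fun y x => if y = f x then 1 else 0
  unitary := by
    rw [Matrix.mem_unitaryGroup_iff]
    ext y z
    have key : ∀ b : Bits n, z = f b ↔ f z = b := fun b =>
      ⟨fun h => by rw [h, hf b], fun h => by rw [← h, hf z]⟩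
    simp [Matrix.mul_apply, Matrix.star_apply, Matrix.one_apply, key, hf z]

/-- `CNOT`, with the first qubit as control: `|a, b⟩ ↦ |a, a ⊕ b⟩`. -/
def cnot : Gate :=
  ofInvolution (fun x : Bits 2 => ![x 0, x 0 + x 1]) (by unfold Function.Involutive; decide)

/-- The Fredkin gate (controlled `SWAP`), with the first qubit as control:
`|0, b, c⟩ ↦ |0, b, c⟩` and `|1, b, c⟩ ↦ |1, c, b⟩`. -/
def fredkin : Gate :=
  ofInvolution (fun x : Bits 3 => if x 0 = 1 then ![x 0, x 2, x 1] else x)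
    (by unfold Function.Involutive; decide)

/-- The single-qubit phase gate `E = diag(1, e^{iδ})`. -/
def phaseE (δ : ℝ) : Gate :=
  single ⟨Matrix.diagonal ![1, Complex.exp (δ * Complex.I)], by
    rw [Matrix.mem_unitaryGroup_iff, Matrix.star_eq_conjTranspose,
      Matrix.diagonal_conjTranspose, Matrix.diagonal_mul_diagonal, ← Matrix.diagonal_one]
    congr 1
    funext i
    fin_cases i
    · simp
    · simp [Complex.mul_conj, Complex.normSq_eq_norm_sq, Complex.norm_exp_ofReal_mul_I]⟩

end WeightCircuit

end

/-! Let `M` be the closure of the unitary circuits on `n + 2` qubits. It is a compact monoid of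
unitaries, hence a group: the powers of a unitary accumulate, so its inverse is a limit of powers
(`star_mem_of_isClosed`).

Universality is needed on one qubit only, where CNOT has no placement. There it says that a closed
subgroup of `U(2)` containing the `U i` contains every unitary up to a phase. Commutators cancel
phases, and every element of `rotations` is a commutator of two others, so `M` contains `Â` for each
such `A` on every pair of qubits. The Fredkin gate is the hat of the bit flip with a control. The
commutator of two controlled gates is controlled by the conjunction of their conditions, so fully
controlled rotations arise. These are rotations in the plane of two labels that differ by exchanging
a 0 and a 1; conjugation by quarter turns reaches all planes of two labels of equal weight
(`twoLevel_mem`).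

Such rotations have determinant one on each weight space, and the ancillas remove this constraint.
The gate `diag(e^{iθ}, e^{-iθ})` on the plane of `|x,01⟩, |x,10⟩` acts on states with ancilla `01`
as a phase on `|x⟩` alone (`phase_mul_ancillaMatrix`), so all diagonal unitaries are implementable.

For a general `V`, maximise a weighted real trace of `g V h` over implementable, weight-preserving
`g, h`. No rotation increases the maximum, which forces `g V h` to be diagonal
(`mem_of_twoLevel_mem`). Hence `V` is implementable. -/

noncomputable section

namespace WeightCircuit

open Topology Filter

/-! ### Compact groups of unitaries, and diagonalisation by a trace maximum. -/

section Generic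

variable {ι : Type*} [Fintype ι] [DecidableEq ι]

theorem isClosed_unitaryGroup :
    IsClosed (Matrix.unitaryGroup ι ℂ : Set (Matrix ι ι ℂ)) := by
  have : (Matrix.unitaryGroup ι ℂ : Set (Matrix ι ι ℂ)) = {A | A * star A = 1} := by
    ext A
    exact Matrix.mem_unitaryGroup_iff
  rw [this]
  exact isClosed_eq (by simp only [Matrix.star_eq_conjTranspose]; fun_prop) continuous_const

theorem isCompact_unitaryGroup :
    IsCompact (Matrix.unitaryGroup ι ℂ : Set (Matrix ι ι ℂ)) := by
  have h : IsCompact (Set.pi Set.univ fun _ : ι => Set.pi Set.univ fun _ : ι =>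
      Metric.closedBall (0 : ℂ) 1) :=
    isCompact_univ_pi fun _ => isCompact_univ_pi fun _ => isCompact_closedBall _ _
  refine h.of_isClosed_subset isClosed_unitaryGroup fun A hA i _ j _ => ?_
  simpa using entry_norm_bound_of_unitary hA i j

/-- A closed submonoid of the unitary group is stable under inverses. -/
theorem star_mem_of_isClosed {M : Submonoid (Matrix ι ι ℂ)} (hM : M ≤ Matrix.unitaryGroup ι ℂ)
    (hc : IsClosed (M : Set (Matrix ι ι ℂ))) {u : Matrix ι ι ℂ} (hu : u ∈ M) : star u ∈ M := by
  have hK : IsCompact (M : Set (Matrix ι ι ℂ)) := isCompact_unitaryGroup.of_isClosed_subset hc hM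
  have : FirstCountableTopology (Matrix ι ι ℂ) :=
    inferInstanceAs (FirstCountableTopology (ι → ι → ℂ))
  obtain ⟨L, hL, φ, hφ, hlim⟩ := hK.tendsto_subseq (x := fun k : ℕ => u ^ k)
    (fun k => M.pow_mem hu k)
  have hs : ∀ k : ℕ, star (u ^ k) * u ^ k = 1 := fun k =>
    Matrix.mem_unitaryGroup_iff'.1 (hM (M.pow_mem hu k))
  have hu' : u * star u = 1 := Matrix.mem_unitaryGroup_iff.1 (hM hu)
  have hstar : Continuous (star : Matrix ι ι ℂ → Matrix ι ι ℂ) :=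
    continuous_id.matrix_conjTranspose
  -- Consecutive terms of the convergent subsequence have quotient tending to 1, so these elements
  -- tend to `star u`. As `φ` is strictly increasing, each is a power of `u` with exponent `φ (k +
  -- 1) - φ k - 1 ≥ 0`.
  have h1 : Tendsto (fun k => star (u ^ φ k) * u ^ φ (k + 1) * star u) atTop
      (𝓝 (star L * L * star u)) :=
    ((((hstar.tendsto L).comp hlim).mul (hlim.comp (tendsto_add_atTop_nat 1)))).mul
      tendsto_const_nhds
  rw [Matrix.mem_unitaryGroup_iff'.1 (hM hL), one_mul] at h1
  refine hc.mem_of_tendsto h1 (Eventually.of_forall fun k => ?_)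
  have hlt : φ k < φ (k + 1) := hφ (Nat.lt_succ_self k)
  obtain ⟨d, hd⟩ := Nat.exists_eq_add_of_lt hlt
  have : star (u ^ φ k) * u ^ φ (k + 1) * star u = u ^ d := by
    rw [hd, pow_succ, pow_add, ← mul_assoc, ← mul_assoc, hs, one_mul, mul_assoc, hu', mul_one]
  rw [this]
  exact M.pow_mem hu d

/-- The operator acting as `A` on the span of the basis vectors `x, y`, and as the identity on the
other basis vectors. -/
def twoLevel (x y : ι) (A : Matrix (Fin 2) (Fin 2) ℂ) : Matrix ι ι ℂ :=
  Matrix.of fun z w =>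
    if z = x then A 0 0 * (1 : Matrix ι ι ℂ) x w + A 0 1 * (1 : Matrix ι ι ℂ) y w
    else if z = y then A 1 0 * (1 : Matrix ι ι ℂ) x w + A 1 1 * (1 : Matrix ι ι ℂ) y w
    else (1 : Matrix ι ι ℂ) z w

theorem twoLevel_mul_apply {κ : Type*} (x y : ι) (A : Matrix (Fin 2) (Fin 2) ℂ)
    (B : Matrix ι κ ℂ) (z : ι) (w : κ) :
    (twoLevel x y A * B) z w =
      if z = x then A 0 0 * B x w + A 0 1 * B y w
      else if z = y then A 1 0 * B x w + A 1 1 * B y w else B z w := by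
  rw [Matrix.mul_apply]
  simp only [twoLevel, Matrix.of_apply]
  split_ifs <;>
    simp [add_mul, mul_assoc, Finset.sum_add_distrib, ← Finset.mul_sum, ← Matrix.mul_apply]

theorem mul_twoLevel_apply {κ : Type*} {x y : ι} (hxy : x ≠ y) (A : Matrix (Fin 2) (Fin 2) ℂ)
    (B : Matrix κ ι ℂ) (z : κ) (w : ι) :
    (B * twoLevel x y A) z w =
      if w = x then B z x * A 0 0 + B z y * A 1 0
      else if w = y then B z x * A 0 1 + B z y * A 1 1 else B z w := by
  have h : (twoLevel x y A).transpose = twoLevel x y A.transpose := by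
    ext u v
    simp only [twoLevel, Matrix.transpose_apply, Matrix.of_apply, Matrix.one_apply]
    grind
  have h' : (B * twoLevel x y A) z w = (twoLevel x y A.transpose * B.transpose) w z := by
    rw [← h, ← Matrix.transpose_mul, Matrix.transpose_apply]
  rw [h', twoLevel_mul_apply]
  simp only [Matrix.transpose_apply, mul_comm]

/-- The quarter turn carries the basis vector `y` to `z` and fixes `x`, so conjugation moves the
plane without changing `A`. A swap would do the same, but has determinant -1 and is not among the
available rotations. -/
theorem twoLevel_conj {x y z : ι} (hxy : x ≠ y) (hyz : y ≠ z) (hxz : x ≠ z)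
    (A : Matrix (Fin 2) (Fin 2) ℂ) :
    twoLevel y z !![0, -1; 1, 0] * (twoLevel x y A * twoLevel y z !![0, 1; -1, 0]) =
      twoLevel x z A := by
  ext u v
  simp only [twoLevel_mul_apply]
  simp only [twoLevel, Matrix.of_apply, Matrix.one_apply, Matrix.cons_val_zero, Matrix.cons_val_one,
    Matrix.cons_val', Matrix.cons_val_fin_one]
  grind

/-- The rotation `exp (t J)` with `J = !![0, -e^{-iφ}; e^{iφ}, 0]`. -/
def rot (t φ : ℝ) : Matrix (Fin 2) (Fin 2) ℂ :=
  !![(Real.cos t : ℂ), -(Complex.exp (-(φ * Complex.I)) * Real.sin t);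
    Complex.exp (φ * Complex.I) * Real.sin t, (Real.cos t : ℂ)]

/-- The left side is maximal at `t = 0`, where its derivative is `q`. -/
theorem eq_zero_of_forall_cos_sin_le {p q : ℝ} (h : ∀ t : ℝ, p * Real.cos t + q * Real.sin t ≤ p) :
    q = 0 := by
  have hmax : IsLocalMax (fun t : ℝ => p * Real.cos t + q * Real.sin t) 0 :=
    Eventually.of_forall fun t => by simpa using h t
  have hd : HasDerivAt (fun t : ℝ => p * Real.cos t + q * Real.sin t)
      (p * (-Real.sin 0) + q * Real.cos 0) 0 :=
    ((Real.hasDerivAt_cos 0).const_mul p).add ((Real.hasDerivAt_sin 0).const_mul q)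
  simpa using hmax.hasDerivAt_eq_zero hd

/-- The angle 0 compares real parts and the angle `π / 2` imaginary parts. -/
theorem eq_conj_of_forall_re_eq {u v : ℂ}
    (h : ∀ φ : ℝ, (Complex.exp (φ * Complex.I) * u).re =
      (Complex.exp (-(φ * Complex.I)) * v).re) : u = starRingEnd ℂ v := by
  have h0 := h 0
  have h1 := h (Real.pi / 2)
  have e1 : Complex.exp (((Real.pi / 2 : ℝ) : ℂ) * Complex.I) = Complex.I := by
    push_cast; exact Complex.exp_pi_div_two_mul_I
  rw [Complex.exp_neg, e1] at h1
  apply Complex.ext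
  · simpa using h0
  · simp at h1
    simp [← h1]

/-- The operators that are block diagonal with respect to the fibres of `w`. -/
def blockDiagonal (w : ι → ℕ) : Submonoid (Matrix ι ι ℂ) where
  carrier := {A | ∀ x y, w y ≠ w x → A y x = 0}
  one_mem' := fun x y h => Matrix.one_apply_ne fun e => h (by rw [e])
  mul_mem' := by
    intro A B hA hB x y h
    rw [Matrix.mul_apply]
    refine Finset.sum_eq_zero fun z _ => ?_
    by_cases hz : w z = w x
    · rw [hA z y (by rwa [hz]), zero_mul]
    · rw [hB x z hz, mul_zero]

theorem isClosed_blockDiagonal (w : ι → ℕ) :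
    IsClosed (blockDiagonal w : Set (Matrix ι ι ℂ)) := by
  have : (blockDiagonal w : Set (Matrix ι ι ℂ)) =
      ⋂ (x : ι) (y : ι) (_ : w y ≠ w x), {A | A y x = 0} := by
    ext A
    simp [blockDiagonal]
  rw [this]
  refine isClosed_iInter fun x => isClosed_iInter fun y => isClosed_iInter fun _ => ?_
  exact isClosed_eq (by fun_prop) continuous_const

theorem twoLevel_mem_blockDiagonal {w : ι → ℕ} {x y : ι} (h : w x = w y)
    (A : Matrix (Fin 2) (Fin 2) ℂ) : twoLevel x y A ∈ blockDiagonal w := by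
  intro u v huv
  simp only [twoLevel, Matrix.of_apply, Matrix.one_apply]
  grind

/-- A weighted real trace that does not increase under left and right multiplication by rotations
in the plane of `x, y` forces the `x y` entry to vanish. -/
theorem apply_eq_zero_of_isMax {c : ι → ℝ} (W : Matrix ι ι ℂ) {x y : ι}
    (hxy : x ≠ y) (hc : c x ^ 2 ≠ c y ^ 2)
    (hl : ∀ t φ : ℝ, (∑ z, c z * ((twoLevel x y (rot t φ) * W) z z).re) ≤ ∑ z, c z * (W z z).re)
    (hr : ∀ t φ : ℝ, (∑ z, c z * ((W * twoLevel x y (rot t φ)) z z).re) ≤ ∑ z, c z * (W z z).re) :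
    W x y = 0 := by
  have key : ∀ B : Matrix ι ι ℂ, (∀ z, z ≠ x ∧ z ≠ y → B z z = W z z) →
      (∑ z, c z * (B z z).re) ≤ ∑ z, c z * (W z z).re →
      c x * (B x x).re + c y * (B y y).re ≤ c x * (W x x).re + c y * (W y y).re := by
    intro B hB h
    rw [← sub_nonpos, ← Finset.sum_sub_distrib] at h
    rw [Fintype.sum_eq_add x y hxy (fun z hz => by rw [hB z hz, sub_self])] at h
    linarith
  have hL : ∀ φ : ℝ, (Complex.exp (φ * Complex.I) * (c y * W x y)).re =
      (Complex.exp (-(φ * Complex.I)) * (c x * W y x)).re := by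
    intro φ
    have h0 := eq_zero_of_forall_cos_sin_le
      (p := c x * (W x x).re + c y * (W y y).re)
      (q := (Complex.exp (φ * Complex.I) * (c y * W x y)).re -
        (Complex.exp (-(φ * Complex.I)) * (c x * W y x)).re) fun t => by
        have h := key _ (fun z hz => by
          rw [twoLevel_mul_apply, if_neg hz.1, if_neg hz.2]) (hl t φ)
        simp only [twoLevel_mul_apply, if_true, if_neg hxy.symm] at h
        refine le_trans (le_of_eq ?_) h
        simp only [rot]
        generalize Complex.exp (φ * Complex.I) = z
        generalize Complex.exp (-(φ * Complex.I)) = z'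
        simp [-Complex.ofReal_sin, -Complex.ofReal_cos]
        ring
    linarith
  have hR : ∀ φ : ℝ, (Complex.exp (φ * Complex.I) * (c x * W x y)).re =
      (Complex.exp (-(φ * Complex.I)) * (c y * W y x)).re := by
    intro φ
    have h0 := eq_zero_of_forall_cos_sin_le
      (p := c x * (W x x).re + c y * (W y y).re)
      (q := (Complex.exp (φ * Complex.I) * (c x * W x y)).re -
        (Complex.exp (-(φ * Complex.I)) * (c y * W y x)).re) fun t => by
        have h := key _ (fun z hz => by
          rw [mul_twoLevel_apply hxy, if_neg hz.1, if_neg hz.2]) (hr t φ)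
        simp only [mul_twoLevel_apply hxy, if_true, if_neg hxy.symm] at h
        refine le_trans (le_of_eq ?_) h
        simp only [rot]
        generalize Complex.exp (φ * Complex.I) = z
        generalize Complex.exp (-(φ * Complex.I)) = z'
        simp [-Complex.ofReal_sin, -Complex.ofReal_cos]
        ring
    linarith
  have h1 := eq_conj_of_forall_re_eq hL
  have h2 := eq_conj_of_forall_re_eq hR
  simp only [map_mul, Complex.conj_ofReal] at h1 h2
  -- Stationarity on the left gives `c y * W x y = c x * conj (W y x)`, on the right the same with
  -- `c x` and `c y` exchanged. Eliminating `W y x` leaves the difference of squares.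
  have h3 : ((c x : ℂ) ^ 2 - (c y : ℂ) ^ 2) * W x y = 0 := by
    linear_combination (c x : ℂ) * h2 - (c y : ℂ) * h1
  refine (mul_eq_zero.1 h3).resolve_left fun h => hc ?_
  exact_mod_cast sub_eq_zero.1 h

/-- A closed group of unitaries which contains the rotations in all planes spanned by two basis
vectors of the same block, and all diagonal unitaries, contains all block diagonal unitaries. -/
theorem mem_of_twoLevel_mem {M : Submonoid (Matrix ι ι ℂ)} (hM : M ≤ Matrix.unitaryGroup ι ℂ)
    (hc : IsClosed (M : Set (Matrix ι ι ℂ))) (w : ι → ℕ)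
    (hT : ∀ x y, x ≠ y → w x = w y → ∀ t φ : ℝ, twoLevel x y (rot t φ) ∈ M)
    (hD : ∀ d : ι → ℂ, (∀ x, ‖d x‖ = 1) → Matrix.diagonal d ∈ M)
    {V : Matrix ι ι ℂ} (hV : V ∈ Matrix.unitaryGroup ι ℂ) (hVw : V ∈ blockDiagonal w) : V ∈ M := by
  -- Any distinct positive weights serve: positivity makes their squares distinct too.
  let c : ι → ℝ := fun x => (Fintype.equivFin ι x : ℕ) + 1
  have hcc : ∀ x y, x ≠ y → c x ^ 2 ≠ c y ^ 2 := by
    intro x y hxy h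
    have h1 : c x = c y := by
      refine (pow_left_inj₀ ?_ ?_ two_ne_zero).1 h <;> positivity
    have h2 : ((Fintype.equivFin ι x : ℕ) : ℝ) = (Fintype.equivFin ι y : ℕ) := by
      simpa [c] using h1
    exact hxy ((Fintype.equivFin ι).injective (Fin.ext (by exact_mod_cast h2)))
  -- Restricting to block diagonal `g, h` keeps the entries of `g V h` between different blocks
  -- zero; only planes inside a block need rotations.
  let M' : Submonoid (Matrix ι ι ℂ) := M ⊓ blockDiagonal w
  have hK : IsCompact (M' : Set (Matrix ι ι ℂ)) :=
    isCompact_unitaryGroup.of_isClosed_subset (hc.inter (isClosed_blockDiagonal w))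
      (fun A hA => hM hA.1)
  obtain ⟨⟨g, h⟩, ⟨hg, hh⟩, hmax⟩ := (hK.prod hK).exists_isMaxOn
    ⟨(1, 1), M'.one_mem, M'.one_mem⟩
    (f := fun p : Matrix ι ι ℂ × Matrix ι ι ℂ => ∑ z, c z * ((p.1 * V * p.2) z z).re)
    (by
      refine Continuous.continuousOn (continuous_finsetSum _ fun z _ => continuous_const.mul ?_)
      refine Complex.continuous_re.comp ?_
      have : Continuous fun p : Matrix ι ι ℂ × Matrix ι ι ℂ => p.1 * V * p.2 := by fun_prop
      exact this.matrix_elem z z)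
  replace hg : g ∈ M' := hg
  replace hh : h ∈ M' := hh
  have hmax' : ∀ a ∈ M', ∀ b ∈ M', (∑ z, c z * ((a * V * b) z z).re) ≤
      ∑ z, c z * ((g * V * h) z z).re := fun a ha b hb => hmax (a := (a, b)) ⟨ha, hb⟩
  have hW : (g * V * h) ∈ Matrix.unitaryGroup ι ℂ :=
    mul_mem (mul_mem (hM hg.1) hV) (hM hh.1)
  have hWw : (g * V * h) ∈ blockDiagonal w := mul_mem (mul_mem hg.2 hVw) hh.2
  have hdiag : ∀ x y, x ≠ y → (g * V * h) x y = 0 := by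
    intro x y hxy
    by_cases hw : w x = w y
    · have hTm : ∀ t φ, twoLevel x y (rot t φ) ∈ M' := fun t φ =>
        ⟨hT x y hxy hw t φ, twoLevel_mem_blockDiagonal hw _⟩
      refine apply_eq_zero_of_isMax _ hxy (hcc x y hxy) (fun t φ => ?_) fun t φ => ?_
      · simpa only [mul_assoc] using hmax' _ (mul_mem (hTm t φ) hg) h hh
      · simpa only [mul_assoc] using hmax' g hg _ (mul_mem hh (hTm t φ))
    · exact hWw y x hw
  have hWd : g * V * h = Matrix.diagonal fun x => (g * V * h) x x := by
    ext x y
    by_cases hxy : x = y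
    · subst hxy; simp
    · rw [Matrix.diagonal_apply_ne _ hxy, hdiag x y hxy]
  have hWM : g * V * h ∈ M := by
    rw [hWd]
    refine hD _ fun x => ?_
    have h1 := congrFun (congrFun (Matrix.mem_unitaryGroup_iff.1 hW) x) x
    rw [hWd, Matrix.star_eq_conjTranspose, Matrix.diagonal_conjTranspose,
      Matrix.diagonal_mul_diagonal, Matrix.diagonal_apply_eq, Matrix.one_apply_eq,
      Pi.star_apply, Complex.star_def, Complex.mul_conj, Complex.normSq_eq_norm_sq] at h1
    have h2 : ‖(g * V * h) x x‖ ^ 2 = 1 := by exact_mod_cast h1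
    exact (pow_eq_one_iff_of_nonneg (norm_nonneg _) two_ne_zero).1 h2
  have hfin : V = star g * (g * V * h) * star h := by
    have e1 : star g * g = 1 := Matrix.mem_unitaryGroup_iff'.1 (hM hg.1)
    have e2 : h * star h = 1 := Matrix.mem_unitaryGroup_iff.1 (hM hh.1)
    calc V = (star g * g) * V * (h * star h) := by rw [e1, e2, one_mul, mul_one]
      _ = _ := by simp only [mul_assoc]
  rw [hfin]
  exact mul_mem (mul_mem (star_mem_of_isClosed hM hc hg.1) hWM) (star_mem_of_isClosed hM hc hh.1)

end Generic

/-! ### Controlled operators on a pair of qubits. -/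

section PairOp

variable {n : ℕ} {a b : Fin n}

/-- The label `y` with the bits `a, b` replaced by `i, 1 - i`. -/
def setPair (a b : Fin n) (y : Bits n) (i : Fin 2) : Bits n :=
  Function.update (Function.update y a i) b (i + 1)

/-- The label `y` with the bits `a, b` erased. -/
def erasePair (a b : Fin n) (y : Bits n) : Bits n :=
  Function.update (Function.update y a 0) b 0

theorem setPair_fst (hab : a ≠ b) (y : Bits n) (i : Fin 2) : setPair a b y i a = i := by
  simp [setPair, hab]

theorem setPair_snd (y : Bits n) (i : Fin 2) : setPair a b y i b = i + 1 := by
  simp [setPair]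

theorem setPair_of_ne {c : Fin n} (ha : c ≠ a) (hb : c ≠ b) (y : Bits n) (i : Fin 2) :
    setPair a b y i c = y c := by
  simp [setPair, ha, hb]

theorem erasePair_of_ne {c : Fin n} (ha : c ≠ a) (hb : c ≠ b) (y : Bits n) :
    erasePair a b y c = y c := by
  simp [erasePair, ha, hb]

theorem erasePair_setPair (y : Bits n) (i : Fin 2) :
    erasePair a b (setPair a b y i) = erasePair a b y := by
  funext c
  simp only [erasePair, setPair, Function.update_apply]
  split_ifs <;> rfl

theorem setPair_setPair (y : Bits n) (i j : Fin 2) :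
    setPair a b (setPair a b y i) j = setPair a b y j := by
  funext c
  simp only [setPair, Function.update_apply]
  split_ifs <;> rfl

theorem fin_two_ne_add_one (i : Fin 2) : i ≠ i + 1 := by
  revert i; decide

theorem fin_two_eq_add_one {i j : Fin 2} (h : i ≠ j) : j = i + 1 := by
  revert i j; decide

theorem setPair_self {y : Bits n} (h : y a ≠ y b) : setPair a b y (y a) = y := by
  funext c
  simp only [setPair, Function.update_apply]
  split_ifs with hb ha
  · rw [hb, fin_two_eq_add_one h]
  · rw [ha]
  · rfl

/-- The operator which acts on the qubits `a, b` as the matrix `f p`, on the span of `|01⟩, |10⟩`,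
where `p` is the label of the other qubits. -/
def pairMatrix (a b : Fin n) (f : Bits n → Matrix (Fin 2) (Fin 2) ℂ) : Op n :=
  Matrix.of fun y x =>
    if y a ≠ y b then ∑ i, f (erasePair a b y) (y a) i * (1 : Op n) (setPair a b y i) x
    else (1 : Op n) y x

theorem pairMatrix_mul_apply {κ : Type*} (f : Bits n → Matrix (Fin 2) (Fin 2) ℂ)
    (B : Matrix (Bits n) κ ℂ) (y : Bits n) (x : κ) :
    (pairMatrix a b f * B) y x =
      if y a ≠ y b then ∑ i, f (erasePair a b y) (y a) i * B (setPair a b y i) x else B y x := by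
  rw [Matrix.mul_apply]
  simp only [pairMatrix, Matrix.of_apply]
  split_ifs
  · simp only [Fin.sum_univ_two, add_mul, mul_assoc, Finset.sum_add_distrib, ← Finset.mul_sum,
      ← Matrix.mul_apply, Matrix.one_mul]
  · rw [← Matrix.mul_apply, Matrix.one_mul]

theorem pairMatrix_apply (hab : a ≠ b) (f : Bits n → Matrix (Fin 2) (Fin 2) ℂ) (y x : Bits n) :
    pairMatrix a b f y x =
      if y a ≠ y b ∧ x a ≠ x b ∧ ∀ c, c ≠ a → c ≠ b → y c = x c then
        f (erasePair a b y) (y a) (x a)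
      else if y = x then 1 else 0 := by
  have key : ∀ i, setPair a b y i = x ↔
      i = x a ∧ (x a ≠ x b ∧ ∀ c, c ≠ a → c ≠ b → y c = x c) := by
    intro i
    constructor
    · rintro rfl
      refine ⟨(setPair_fst hab y i).symm, ?_, fun c ha hb => (setPair_of_ne ha hb y i).symm⟩
      rw [setPair_fst hab, setPair_snd]
      exact fin_two_ne_add_one i
    · rintro ⟨rfl, h, hc⟩
      funext c
      simp only [setPair, Function.update_apply]
      split_ifs with hb ha
      · rw [hb, fin_two_eq_add_one h]
      · rw [ha]
      · exact hc c ha hb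
  simp only [pairMatrix, Matrix.of_apply, Matrix.one_apply, key]
  by_cases h1 : y a ≠ y b
  · by_cases h2 : x a ≠ x b ∧ ∀ c, c ≠ a → c ≠ b → y c = x c
    · rw [if_pos h1, if_pos ⟨h1, h2⟩]
      simp only [and_iff_left h2, mul_ite, mul_one, mul_zero, Finset.sum_ite_eq', Finset.mem_univ,
        if_true]
    · have h3 : y ≠ x := by
        rintro rfl
        exact h2 ⟨h1, fun _ _ _ => rfl⟩
      rw [if_pos h1, if_neg (fun h => h2 h.2), if_neg h3]
      simp [h2]
  · rw [if_neg h1, if_neg (not_and_of_not_left _ h1)]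

/-- Acting on the bits `a, b` leaves the label of the other qubits unchanged, so the blocks multiply
independently. Identities between controlled gates thus become pointwise identities in `U(2)`. -/
theorem pairMatrix_mul (hab : a ≠ b) (f g : Bits n → Matrix (Fin 2) (Fin 2) ℂ) :
    pairMatrix a b (f * g) = pairMatrix a b f * pairMatrix a b g := by
  ext y x
  rw [pairMatrix_mul_apply]
  by_cases h : y a ≠ y b
  · simp only [pairMatrix, Matrix.of_apply, if_pos h, setPair_fst hab, setPair_snd,
      erasePair_setPair, Pi.mul_apply, Matrix.mul_apply, Fin.sum_univ_two,
      fin_two_ne_add_one, ne_eq, not_false_eq_true, if_true]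
    simp only [Matrix.one_apply, setPair_setPair]
    ring
  · simp only [pairMatrix, Matrix.of_apply, if_neg h]

theorem pairMatrix_one : pairMatrix a b (1 : Bits n → Matrix (Fin 2) (Fin 2) ℂ) = 1 := by
  ext y x
  simp only [pairMatrix, Matrix.of_apply, Pi.one_apply]
  split_ifs with h
  · simp only [Matrix.one_apply (i := y a), ite_mul, one_mul, zero_mul, Finset.sum_ite_eq,
      Finset.mem_univ, if_true]
    simp only [Matrix.one_apply, setPair_self h]
  · rfl

theorem star_pairMatrix (hab : a ≠ b) (f : Bits n → Matrix (Fin 2) (Fin 2) ℂ) :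
    star (pairMatrix a b f) = pairMatrix a b (star f) := by
  ext y x
  rw [Matrix.star_apply, pairMatrix_apply hab, pairMatrix_apply hab]
  by_cases h : y a ≠ y b ∧ x a ≠ x b ∧ ∀ c, c ≠ a → c ≠ b → y c = x c
  · have h' : x a ≠ x b ∧ y a ≠ y b ∧ ∀ c, c ≠ a → c ≠ b → x c = y c :=
      ⟨h.2.1, h.1, fun c ha hb => (h.2.2 c ha hb).symm⟩
    have e : erasePair a b x = erasePair a b y := by
      funext c
      simp only [erasePair, Function.update_apply]
      split_ifs with hb ha
      · rfl
      · rfl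
      · exact (h.2.2 c ha hb).symm
    rw [if_pos h, if_pos h', e, Pi.star_apply, Matrix.star_apply]
  · have h' : ¬ (x a ≠ x b ∧ y a ≠ y b ∧ ∀ c, c ≠ a → c ≠ b → x c = y c) :=
      fun h' => h ⟨h'.2.1, h'.1, fun c ha hb => (h'.2.2 c ha hb).symm⟩
    rw [if_neg h, if_neg h']
    simp only [eq_comm (a := x)]
    split_ifs <;> simp

/-- `pairMatrix` as a homomorphism on functions with values in `U(2)`. -/
def pairHom (hab : a ≠ b) : (Bits n → Matrix.unitaryGroup (Fin 2) ℂ) →* Op n where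
  toFun f := pairMatrix a b fun p => f p
  map_one' := pairMatrix_one
  map_mul' f g := pairMatrix_mul hab (fun p => f p) fun p => g p

theorem pairHom_apply (hab : a ≠ b) (f : Bits n → Matrix.unitaryGroup (Fin 2) ℂ) :
    pairHom hab f = pairMatrix a b fun p => (f p : Matrix (Fin 2) (Fin 2) ℂ) := rfl

theorem star_pairHom (hab : a ≠ b) (f : Bits n → Matrix.unitaryGroup (Fin 2) ℂ) :
    star (pairHom hab f) = pairHom hab f⁻¹ :=
  star_pairMatrix hab fun p => (f p : Matrix (Fin 2) (Fin 2) ℂ)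

theorem pairHom_mem_unitaryGroup (hab : a ≠ b) (f : Bits n → Matrix.unitaryGroup (Fin 2) ℂ) :
    pairHom hab f ∈ Matrix.unitaryGroup (Bits n) ℂ := by
  rw [Matrix.mem_unitaryGroup_iff, star_pairHom, ← map_mul, mul_inv_cancel, map_one]

/-- The functions `f` for which the operator `pairHom hab f` belongs to `M`. -/
def pairSubgroup (M : Submonoid (Op n)) (hM : ∀ u ∈ M, star u ∈ M) (hab : a ≠ b) :
    Subgroup (Bits n → Matrix.unitaryGroup (Fin 2) ℂ) where
  toSubmonoid := M.comap (pairHom hab)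
  inv_mem' := by
    intro f hf
    have := hM _ (Submonoid.mem_comap.1 hf)
    rwa [star_pairHom] at this

end PairOp

/-! ### Rotations and phases as commutators. -/

section Rotations

theorem conj_exp_mul_I (φ : ℝ) :
    starRingEnd ℂ (Complex.exp (φ * Complex.I)) = Complex.exp (-(φ * Complex.I)) := by
  rw [← Complex.exp_conj]; simp

theorem conj_exp_neg_mul_I (φ : ℝ) :
    starRingEnd ℂ (Complex.exp (-(φ * Complex.I))) = Complex.exp (φ * Complex.I) := by
  rw [← Complex.exp_conj]; simp

theorem exp_mul_exp_neg (z : ℂ) : Complex.exp z * Complex.exp (-z) = 1 := by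
  rw [← Complex.exp_add, add_neg_cancel, Complex.exp_zero]

/-- `rot` as a unitary. -/
def rotU (t φ : ℝ) : Matrix.unitaryGroup (Fin 2) ℂ := ⟨rot t φ, by
  rw [Matrix.mem_unitaryGroup_iff]
  have h := exp_mul_exp_neg (φ * Complex.I)
  have h1 : (Real.cos t : ℂ) ^ 2 + (Real.sin t : ℂ) ^ 2 = 1 := by
    exact_mod_cast Real.cos_sq_add_sin_sq t
  ext i j
  fin_cases i <;> fin_cases j <;>
    simp [rot, Matrix.mul_apply, Matrix.star_apply, conj_exp_mul_I, conj_exp_neg_mul_I,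
      -Complex.ofReal_sin, -Complex.ofReal_cos] <;>
    generalize Complex.exp (φ * Complex.I) = z at * <;>
    generalize Complex.exp (-(φ * Complex.I)) = z' at *
  · linear_combination h1 + (Real.sin t : ℂ) ^ 2 * h
  · ring
  · ring
  · linear_combination h1 + (Real.sin t : ℂ) ^ 2 * h⟩

/-- The phase gate `diag(e^{iθ}, e^{-iθ})`. -/
def phaseU (θ : ℝ) : Matrix.unitaryGroup (Fin 2) ℂ :=
  ⟨!![Complex.exp (θ * Complex.I), 0; 0, Complex.exp (-(θ * Complex.I))], by
    rw [Matrix.mem_unitaryGroup_iff]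
    have h := exp_mul_exp_neg (θ * Complex.I)
    ext i j
    fin_cases i <;> fin_cases j <;>
      simp [Matrix.mul_apply, Matrix.star_apply, conj_exp_mul_I, conj_exp_neg_mul_I, h]
    rw [mul_comm, h]⟩

/-- The bit flip. -/
def flipU : Matrix.unitaryGroup (Fin 2) ℂ := ⟨!![0, 1; 1, 0], by
  rw [Matrix.mem_unitaryGroup_iff]
  ext i j
  fin_cases i <;> fin_cases j <;> simp [Matrix.mul_apply, Matrix.star_apply]⟩

theorem rotU_inv (t φ : ℝ) : (rotU t φ)⁻¹ = rotU (-t) φ := by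
  refine Subtype.ext ?_
  change star (rot t φ) = rot (-t) φ
  ext i j
  fin_cases i <;> fin_cases j <;>
    simp [rot, Matrix.star_apply, conj_exp_mul_I, conj_exp_neg_mul_I, ← Complex.cos_conj,
      ← Complex.sin_conj]

theorem phaseU_inv (θ : ℝ) : (phaseU θ)⁻¹ = phaseU (-θ) := by
  refine Subtype.ext ?_
  change star (phaseU θ).1 = (phaseU (-θ)).1
  ext i j
  fin_cases i <;> fin_cases j <;>
    simp [phaseU, Matrix.star_apply, conj_exp_mul_I, conj_exp_neg_mul_I]

theorem flipU_inv : flipU⁻¹ = flipU := by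
  refine Subtype.ext ?_
  change star flipU.1 = flipU.1
  ext i j
  fin_cases i <;> fin_cases j <;> simp [flipU, Matrix.star_apply]

theorem phaseU_half_pi : (phaseU (Real.pi / 2)).1 = !![Complex.I, 0; 0, -Complex.I] := by
  have e1 : Complex.exp (((Real.pi / 2 : ℝ) : ℂ) * Complex.I) = Complex.I := by
    push_cast; exact Complex.exp_pi_div_two_mul_I
  simp only [phaseU]
  rw [Complex.exp_neg, e1, Complex.inv_I]

theorem rot_half_pi : rot (Real.pi / 2) 0 = !![0, -1; 1, 0] := by
  simp [rot]

theorem rot_neg_half_pi : rot (-(Real.pi / 2)) 0 = !![0, 1; -1, 0] := by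
  simp [rot]

/-- Conjugation by `diag(i, -i)` reverses the rotation angle, so the commutator is the square of the
half-angle rotation. -/
theorem rotU_eq_commutator (t φ : ℝ) :
    rotU (t / 2) φ * phaseU (Real.pi / 2) * (rotU (t / 2) φ)⁻¹ * (phaseU (Real.pi / 2))⁻¹ =
      rotU t φ := by
  have h : rotU (t / 2) φ * phaseU (Real.pi / 2) * rotU (-(t / 2)) φ =
      rotU t φ * phaseU (Real.pi / 2) := by
    refine Subtype.ext ?_
    change rot (t / 2) φ * (phaseU (Real.pi / 2)).1 * rot (-(t / 2)) φ =
      rot t φ * (phaseU (Real.pi / 2)).1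
    have e := exp_mul_exp_neg (φ * Complex.I)
    have hc : Real.cos t = Real.cos (t / 2) ^ 2 - Real.sin (t / 2) ^ 2 := by
      rw [← Real.cos_two_mul']; congr 1; ring
    have hs : Real.sin t = 2 * Real.sin (t / 2) * Real.cos (t / 2) := by
      rw [← Real.sin_two_mul]; congr 1; ring
    rw [phaseU_half_pi]
    simp only [rot, hc, hs, Real.cos_neg, Real.sin_neg]
    generalize Complex.exp (φ * Complex.I) = z at *
    generalize Complex.exp (-(φ * Complex.I)) = z' at *
    generalize Real.cos (t / 2) = c at *
    generalize Real.sin (t / 2) = s at *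
    ext i j
    fin_cases i <;> fin_cases j <;> simp [Matrix.mul_apply]
    · linear_combination (-Complex.I * s ^ 2) * e
    · ring
    · ring
    · linear_combination (Complex.I * s ^ 2) * e
  rw [rotU_inv, h, mul_inv_cancel_right]

/-- Conjugation by the quarter turn exchanges the two diagonal entries, that is, inverts the phase
gate. -/
theorem phaseU_eq_commutator (θ : ℝ) :
    phaseU (θ / 2) * rotU (Real.pi / 2) 0 * (phaseU (θ / 2))⁻¹ * (rotU (Real.pi / 2) 0)⁻¹ =
      phaseU θ := by
  have h : phaseU (θ / 2) * rotU (Real.pi / 2) 0 * phaseU (-(θ / 2)) =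
      phaseU θ * rotU (Real.pi / 2) 0 := by
    refine Subtype.ext ?_
    change (phaseU (θ / 2)).1 * rot (Real.pi / 2) 0 * (phaseU (-(θ / 2))).1 =
      (phaseU θ).1 * rot (Real.pi / 2) 0
    rw [rot_half_pi]
    ext i j
    fin_cases i <;> fin_cases j <;>
      simp [phaseU, Matrix.mul_apply, ← Complex.exp_add] <;> ring_nf
  rw [phaseU_inv, h, mul_inv_cancel_right]

theorem phaseU_eq_commutator_flipU (θ : ℝ) :
    flipU * phaseU (-(θ / 2)) * flipU⁻¹ * (phaseU (-(θ / 2)))⁻¹ = phaseU θ := by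
  rw [flipU_inv, phaseU_inv]
  refine Subtype.ext ?_
  change flipU.1 * (phaseU (-(θ / 2))).1 * flipU.1 * (phaseU (-(-(θ / 2)))).1 = (phaseU θ).1
  ext i j
  fin_cases i <;> fin_cases j <;>
    simp [phaseU, flipU, Matrix.mul_apply, ← Complex.exp_add] <;> ring_nf

end Rotations

/-! ### Adding controls by commutators. -/

section Control

/-- The rotations and the phase gates of determinant one. -/
def rotations : Set (Matrix.unitaryGroup (Fin 2) ℂ) :=
  (Set.range fun p : ℝ × ℝ => rotU p.1 p.2) ∪ Set.range phaseU

theorem rotU_mem (t φ : ℝ) : rotU t φ ∈ rotations := Or.inl ⟨(t, φ), rfl⟩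

theorem phaseU_mem (θ : ℝ) : phaseU θ ∈ rotations := Or.inr ⟨θ, rfl⟩

/-- Each rotation is a commutator of rotations. -/
theorem exists_commutator_eq {A : Matrix.unitaryGroup (Fin 2) ℂ} (hA : A ∈ rotations) :
    ∃ B ∈ rotations, ∃ C ∈ rotations, B * C * B⁻¹ * C⁻¹ = A := by
  rcases hA with ⟨⟨t, φ⟩, rfl⟩ | ⟨θ, rfl⟩
  · exact ⟨_, rotU_mem _ _, _, phaseU_mem _, rotU_eq_commutator t φ⟩
  · exact ⟨_, phaseU_mem _, _, rotU_mem _ _, phaseU_eq_commutator θ⟩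

variable {α : Type*} {Λ : Subgroup (α → Matrix.unitaryGroup (Fin 2) ℂ)}

/-- Write `A` as a commutator of `B` and `C`, control `B` by `P` and `C` by `Q`: where either
condition fails, one factor is 1 and the commutator is trivial. -/
theorem ite_and_mem {P Q : α → Prop} [DecidablePred P] [DecidablePred Q]
    (hP : ∀ A ∈ rotations, (fun p => if P p then A else 1) ∈ Λ)
    (hQ : ∀ A ∈ rotations, (fun p => if Q p then A else 1) ∈ Λ) :
    ∀ A ∈ rotations, (fun p => if P p ∧ Q p then A else 1) ∈ Λ := by
  intro A hA
  obtain ⟨B, hB, C, hC, rfl⟩ := exists_commutator_eq hA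
  convert mul_mem (mul_mem (mul_mem (hP B hB) (hQ C hC)) (inv_mem (hP B hB)))
    (inv_mem (hQ C hC)) using 1
  funext p
  by_cases h1 : P p <;> by_cases h2 : Q p <;> simp [h1, h2]

/-- Undo the uncontrolled gate where `P` holds. This turns a control on the value 1 into a control
on the value 0. -/
theorem ite_not_mem {P : α → Prop} [DecidablePred P] (hc : ∀ A ∈ rotations, (fun _ => A) ∈ Λ)
    (hP : ∀ A ∈ rotations, (fun p => if P p then A else 1) ∈ Λ) :
    ∀ A ∈ rotations, (fun p => if ¬ P p then A else 1) ∈ Λ := by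
  intro A hA
  convert mul_mem (hc A hA) (inv_mem (hP A hA)) using 1
  funext p
  by_cases h1 : P p <;> simp [h1]

/-- The flip has determinant -1, so it is only a seed: its commutators with uncontrolled phase gates
are controlled phases, and the commutators of those with uncontrolled rotations are controlled
rotations. -/
theorem ite_mem_of_ite_flipU_mem {P : α → Prop} [DecidablePred P]
    (hc : ∀ A ∈ rotations, (fun _ => A) ∈ Λ) (hP : (fun p => if P p then flipU else 1) ∈ Λ) :
    ∀ A ∈ rotations, (fun p => if P p then A else 1) ∈ Λ := by
  have h1 : ∀ θ, (fun p => if P p then phaseU θ else 1) ∈ Λ := by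
    intro θ
    convert mul_mem (mul_mem (mul_mem hP (hc _ (phaseU_mem (-(θ / 2))))) (inv_mem hP))
      (inv_mem (hc _ (phaseU_mem (-(θ / 2))))) using 1
    funext p
    by_cases h1 : P p
    · simp [h1, phaseU_eq_commutator_flipU]
    · simp [h1]
  rintro A (⟨⟨t, φ⟩, rfl⟩ | ⟨θ, rfl⟩)
  · convert mul_mem (mul_mem (mul_mem (hc _ (rotU_mem (t / 2) φ)) (h1 (Real.pi / 2)))
      (inv_mem (hc _ (rotU_mem (t / 2) φ)))) (inv_mem (h1 (Real.pi / 2))) using 1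
    funext p
    by_cases h1 : P p
    · simp [h1, rotU_eq_commutator]
    · simp [h1]
  · exact h1 θ

theorem ite_forall_mem {n : ℕ} {Λ : Subgroup (Bits n → Matrix.unitaryGroup (Fin 2) ℂ)}
    (hc : ∀ A ∈ rotations, (fun _ => A) ∈ Λ) (x : Bits n) (s : Finset (Fin n))
    (hs : ∀ c ∈ s, (fun p : Bits n => if p c = 1 then flipU else 1) ∈ Λ) :
    ∀ A ∈ rotations, (fun p : Bits n => if ∀ c ∈ s, p c = x c then A else 1) ∈ Λ := by
  induction s using Finset.induction_on with
  | empty => simpa using hc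
  | insert c s _ ih =>
    have h1 := ite_mem_of_ite_flipU_mem hc (hs c (Finset.mem_insert_self c s))
    have h2 : ∀ A ∈ rotations, (fun p : Bits n => if p c = x c then A else 1) ∈ Λ := by
      rcases Fin.exists_fin_two.1 ⟨x c, rfl⟩ with h | h
      · have h3 := ite_not_mem hc h1
        have h4 : ∀ i : Fin 2, ¬ i = 1 ↔ i = 0 := by decide
        simpa only [h4, ← h] using h3
      · simpa only [← h] using h1
    have h3 := ite_and_mem h2 (ih fun d hd => hs d (Finset.mem_insert_of_mem hd))
    simpa only [Finset.forall_mem_insert] using h3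

end Control

/-! ### Rotations in all planes of two labels of equal weight. -/

section Connected

variable {n : ℕ}

theorem weight_comp (x : Bits n) (σ : Equiv.Perm (Fin n)) : weight (x ∘ σ) = weight x := by
  simp only [weight, Finset.card_filter, Function.comp_apply]
  exact Equiv.sum_comp σ fun i => if x i = 1 then 1 else 0

theorem fin_two_eq_zero {i : Fin 2} (h : i ≠ 1) : i = 0 := by
  revert i; decide

theorem exists_ne_of_weight_eq {x y : Bits n} (hxy : x ≠ y) (h : weight x = weight y) :
    ∃ a, x a = 0 ∧ y a = 1 := by
  by_contra! hc
  have hsub : (Finset.univ.filter fun i => y i = 1) ⊆ Finset.univ.filter fun i => x i = 1 := by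
    intro i hi
    rw [Finset.mem_filter] at hi ⊢
    refine ⟨hi.1, ?_⟩
    by_contra h0
    exact hc i (fin_two_eq_zero h0) hi.2
  have heq := Finset.eq_of_subset_of_card_le hsub h.le
  refine hxy (funext fun i => ?_)
  have hi := Finset.ext_iff.1 heq i
  simp only [Finset.mem_filter, Finset.mem_univ, true_and] at hi
  by_cases h1 : x i = 1
  · rw [h1, hi.2 h1]
  · rw [fin_two_eq_zero h1, fin_two_eq_zero fun h2 => h1 (hi.1 h2)]

theorem setPair_eq_comp_swap {a b : Fin n} {x : Bits n} (ha : x a = 0) (hb : x b = 1) :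
    setPair a b x 1 = x ∘ Equiv.swap a b := by
  funext c
  simp only [setPair, Function.update_apply, Function.comp_apply, Equiv.swap_apply_def]
  split_ifs <;> simp_all

/-- With every other qubit controlled to agree with `x`, the only labels moved are `x` and its
exchange of `a, b`. Since `x a = 0`, the label `x` is the first basis vector. -/
theorem pairHom_eq_twoLevel {a b : Fin n} (hab : a ≠ b) {x : Bits n} (ha : x a = 0) (hb : x b = 1)
    (A : Matrix.unitaryGroup (Fin 2) ℂ) :
    pairHom hab (fun p => if ∀ c ∈ ({a, b} : Finset (Fin n))ᶜ, p c = x c then A else 1) =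
      twoLevel x (setPair a b x 1) A := by
  have hx0 : setPair a b x 0 = x := by
    have : x a ≠ x b := by rw [ha, hb]; decide
    simpa [ha] using setPair_self this
  have hcond : ∀ y : Bits n, (∀ c ∈ ({a, b} : Finset (Fin n))ᶜ, erasePair a b y c = x c) ↔
      ∀ c ∈ ({a, b} : Finset (Fin n))ᶜ, y c = x c := by
    intro y
    refine forall₂_congr fun c hc => ?_
    simp only [Finset.mem_compl, Finset.mem_insert, Finset.mem_singleton, not_or] at hc
    rw [erasePair_of_ne hc.1 hc.2]
  have hset : ∀ i : Fin 2, ∀ c ∈ ({a, b} : Finset (Fin n))ᶜ, setPair a b x i c = x c := by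
    intro i c hc
    simp only [Finset.mem_compl, Finset.mem_insert, Finset.mem_singleton, not_or] at hc
    exact setPair_of_ne hc.1 hc.2 x i
  rw [pairHom_apply]
  have hrow : ∀ i : Fin 2, ∀ z, pairMatrix a b
      (fun p => ((if ∀ c ∈ ({a, b} : Finset (Fin n))ᶜ, p c = x c then A else 1 :
        Matrix.unitaryGroup (Fin 2) ℂ) : Matrix (Fin 2) (Fin 2) ℂ))
      (setPair a b x i) z = A.1 i 0 * (1 : Op n) x z + A.1 i 1 * (1 : Op n) (setPair a b x 1) z := by
    intro i z
    simp only [pairMatrix, Matrix.of_apply]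
    rw [if_pos (by rw [setPair_fst hab, setPair_snd]; exact fin_two_ne_add_one i),
      Fin.sum_univ_two, if_pos ((hcond _).2 (hset i)), setPair_setPair, setPair_setPair, hx0,
      setPair_fst hab]
  ext y z
  simp only [twoLevel, Matrix.of_apply]
  split_ifs with h0 h1
  · rw [h0, ← hrow 0 z, hx0]
  · rw [h1, ← hrow 1 z]
  · simp only [pairMatrix, Matrix.of_apply]
    split_ifs with h2 h3
    · exfalso
      have h4 : y = setPair a b x (y a) := by
        funext c
        rw [hcond] at h3
        by_cases hcb : c = b
        · rw [hcb, setPair_snd, fin_two_eq_add_one h2]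
        by_cases hca : c = a
        · rw [hca, setPair_fst hab]
        · rw [setPair_of_ne hca hcb]
          exact h3 c (by simp [hca, hcb])
      rcases Fin.exists_fin_two.1 ⟨y a, rfl⟩ with h | h
      · rw [h, hx0] at h4; exact h0 h4
      · rw [h] at h4; exact h1 h4
    · have h4 := congrFun (congrFun (pairMatrix_one (a := a) (b := b) (n := n)) y) z
      simpa only [pairMatrix, Matrix.of_apply, if_pos h2, Pi.one_apply, OneMemClass.coe_one] using h4
    · rfl

/-- A group of operators which contains the rotations on all pairs of qubits and all controlled
flips on pairs of qubits contains all rotations in planes spanned by two basis vectors of the same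
weight. -/
theorem twoLevel_mem {M : Submonoid (Op n)} (hM : ∀ u ∈ M, star u ∈ M)
    (hrot : ∀ (a b : Fin n) (hab : a ≠ b), ∀ A ∈ rotations, pairHom hab (fun _ => A) ∈ M)
    (hflip : ∀ (a b c : Fin n) (hab : a ≠ b), c ≠ a → c ≠ b →
      pairHom hab (fun p => if p c = 1 then flipU else 1) ∈ M) :
    ∀ (x y : Bits n), x ≠ y → weight x = weight y → ∀ A ∈ rotations, twoLevel x y A.1 ∈ M := by
  suffices h : ∀ (k : ℕ) (x y : Bits n), (Finset.univ.filter fun i => x i ≠ y i).card ≤ k → x ≠ y →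
      weight x = weight y → ∀ A ∈ rotations, twoLevel x y A.1 ∈ M from
    fun x y => h _ x y le_rfl
  intro k
  induction k with
  | zero =>
    intro x y hk hxy
    refine absurd (funext fun i => ?_) hxy
    by_contra hi
    have : i ∈ Finset.univ.filter fun i => x i ≠ y i := by simpa using hi
    rw [Finset.card_eq_zero.1 (Nat.le_zero.1 hk)] at this
    simp at this
  | succ k ih =>
    intro x y hk hxy hw A hA
    obtain ⟨a, hxa, hya⟩ := exists_ne_of_weight_eq hxy hw
    obtain ⟨b, hyb, hxb⟩ := exists_ne_of_weight_eq hxy.symm hw.symm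
    have hab : a ≠ b := by
      rintro rfl
      rw [hxa] at hxb
      exact absurd hxb (by decide)
    have hbase : twoLevel x (setPair a b x 1) A.1 ∈ M := by
      rw [← pairHom_eq_twoLevel hab hxa hxb]
      refine ite_forall_mem (Λ := pairSubgroup M hM hab) (hrot a b hab) x _ (fun c hc => ?_) A hA
      simp only [Finset.mem_compl, Finset.mem_insert, Finset.mem_singleton, not_or] at hc
      exact hflip a b c hab hc.1 hc.2
    by_cases hy : setPair a b x 1 = y
    · rwa [hy] at hbase
    have hx : x ≠ setPair a b x 1 := by
      intro h
      have := congrFun h a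
      rw [setPair_fst hab, hxa] at this
      exact absurd this (by decide)
    have hw' : weight (setPair a b x 1) = weight y := by
      rw [setPair_eq_comp_swap hxa hxb, weight_comp, hw]
    -- The exchange corrects the bits `a` and `b` and touches no other, so the Hamming distance to
    -- `y` drops.
    have hcard : (Finset.univ.filter fun i => setPair a b x 1 i ≠ y i).card ≤ k := by
      refine Nat.le_of_lt_succ (lt_of_lt_of_le (Finset.card_lt_card ?_) hk)
      rw [Finset.ssubset_iff_of_subset]
      · refine ⟨a, ?_, ?_⟩
        · simp [hxa, hya]
        · simp [setPair_fst hab, hya]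
      · intro c hc
        simp only [Finset.mem_filter, Finset.mem_univ, true_and] at hc ⊢
        by_cases hca : c = a
        · rw [hca, hxa, hya]; decide
        by_cases hcb : c = b
        · rw [hcb, hxb, hyb]; decide
        · rwa [setPair_of_ne hca hcb] at hc
    -- The induction hypothesis supplies the quarter turn and its inverse in the plane of the
    -- exchanged label and `y`; they carry the plane of `hbase` to that of `x, y`.
    have h1 := ih _ y hcard hy hw' _ (rotU_mem (Real.pi / 2) 0)
    have h2 := ih _ y hcard hy hw' _ (rotU_mem (-(Real.pi / 2)) 0)
    change twoLevel _ _ (rot _ _) ∈ M at h1 h2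
    rw [rot_half_pi] at h1
    rw [rot_neg_half_pi] at h2
    rw [← twoLevel_conj hx hy hxy]
    exact mul_mem h1 (mul_mem hbase h2)

end Connected

/-! ### The gates of the set as pair operators, and weight preservation. -/

section Gates

variable {n : ℕ}

theorem exists_hat_on_eq (U : Matrix.unitaryGroup (Fin 2) ℂ) {a b : Fin n} (hab : a ≠ b) :
    ∃ e : Fin (hat U).arity ↪ Fin n, pairHom hab (fun _ => U) = (hat U).on e := by
  have hinj : Function.Injective ![a, b] := by
    intro i j h
    fin_cases i <;> fin_cases j <;> simp_all
  let e : Fin 2 ↪ Fin n := ⟨![a, b], hinj⟩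
  refine ⟨e, ?_⟩
  have hcond : ∀ y x : Bits n, (∀ j, (∀ i, e i ≠ j) → y j = x j) ↔
      ∀ c, c ≠ a → c ≠ b → y c = x c := by
    intro y x
    refine forall_congr' fun c => ?_
    simp only [Fin.forall_fin_two]
    simp only [e, Function.Embedding.coeFn_mk, Matrix.cons_val_zero, Matrix.cons_val_one, and_imp,
      ne_comm (b := c)]
  ext y x
  rw [pairHom_apply, pairMatrix_apply hab]
  change _ = if ∀ j, (∀ i, e i ≠ j) → y j = x j then
    hatOp U (fun i => y (e i)) (fun i => x (e i)) else 0
  have hyx : (∀ c, c ≠ a → c ≠ b → y c = x c) →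
      ((fun i => y (e i)) = (fun i => x (e i)) ↔ y = x) := by
    intro h
    constructor
    · intro h'
      funext c
      by_cases hca : c = a
      · rw [hca]; exact congrFun h' 0
      by_cases hcb : c = b
      · rw [hcb]; exact congrFun h' 1
      exact h c hca hcb
    · rintro rfl; rfl
  simp only [hcond, hatOp, Matrix.of_apply]
  by_cases h : ∀ c, c ≠ a → c ≠ b → y c = x c
  · rw [if_pos h]
    simp only [hyx h, and_iff_left h]
    rfl
  · rw [if_neg h, if_neg fun h' => h h'.2.2, if_neg]
    rintro rfl
    exact h fun _ _ _ => rfl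

/-- SWAP fixes `|00⟩, |11⟩` and exchanges `|01⟩, |10⟩`, so it is the hat of the bit flip. -/
theorem exists_fredkin_on_eq {a b c : Fin n} (hab : a ≠ b) (hca : c ≠ a) (hcb : c ≠ b) :
    ∃ e : Fin fredkin.arity ↪ Fin n,
      pairHom hab (fun p => if p c = 1 then flipU else 1) = fredkin.on e := by
  have hinj : Function.Injective ![c, a, b] := by
    intro i j h
    fin_cases i <;> fin_cases j <;> simp_all
  let e : Fin 3 ↪ Fin n := ⟨![c, a, b], hinj⟩
  refine ⟨e, ?_⟩
  have hcond : ∀ y x : Bits n, (∀ j, (∀ i, e i ≠ j) → y j = x j) ↔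
      ∀ d, d ≠ c → d ≠ a → d ≠ b → y d = x d := by
    intro y x
    refine forall_congr' fun d => ?_
    have : (∀ i, e i ≠ d) ↔ d ≠ c ∧ d ≠ a ∧ d ≠ b := by
      rw [Fin.forall_fin_succ, Fin.forall_fin_two, ne_comm, ne_comm (a := d) (b := a),
        ne_comm (a := d) (b := b)]
      rfl
    rw [this]
    tauto
  ext y x
  rw [pairHom_apply, pairMatrix_apply hab, erasePair_of_ne hca hcb]
  change _ = if ∀ j, (∀ i, e i ≠ j) → y j = x j then
    (if (fun i => y (e i)) = (if x c = 1 then ![x c, x b, x a] else fun i => x (e i)) then (1 : ℂ)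
      else 0) else 0
  simp only [hcond]
  have hyx : y = x ↔ (∀ d, d ≠ c → d ≠ a → d ≠ b → y d = x d) ∧
      y c = x c ∧ y a = x a ∧ y b = x b := by
    constructor
    · rintro rfl; simp
    · rintro ⟨h, h1, h2, h3⟩
      funext d
      by_cases hc : d = c
      · rw [hc, h1]
      by_cases ha : d = a
      · rw [ha, h2]
      by_cases hb : d = b
      · rw [hb, h3]
      exact h d hc ha hb
  have hfun : ∀ u : Bits 3, (fun i => y (e i)) = u ↔ y c = u 0 ∧ y a = u 1 ∧ y b = u 2 := by
    intro u
    rw [funext_iff, Fin.forall_fin_succ, Fin.forall_fin_two]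
    rfl
  have hpair : (∀ d, d ≠ a → d ≠ b → y d = x d) ↔
      (∀ d, d ≠ c → d ≠ a → d ≠ b → y d = x d) ∧ y c = x c := by
    constructor
    · exact fun h => ⟨fun d _ => h d, h c hca hcb⟩
    · rintro ⟨h, h1⟩ d ha hb
      by_cases hc : d = c
      · rw [hc, h1]
      · exact h d hc ha hb
  have hflip : ∀ i j : Fin 2, flipU.1 i j = if i ≠ j then 1 else 0 := by
    intro i j
    fin_cases i <;> fin_cases j <;> simp [flipU]
  have hone : ∀ i j : Fin 2, (1 : Matrix.unitaryGroup (Fin 2) ℂ).1 i j = if i = j then 1 else 0 :=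
    fun i j => Matrix.one_apply
  -- Here `i, j` are the output bits and `k, l` the input bits at `a, b`: the left side is the entry
  -- of the hat of the flip, the right side that of SWAP.
  have hswap : ∀ i j k l : Fin 2, (if i ≠ j ∧ k ≠ l then (if i ≠ k then (1 : ℂ) else 0)
      else if i = k ∧ j = l then 1 else 0) = if i = l ∧ j = k then 1 else 0 := by
    intro i j k l
    fin_cases i <;> fin_cases j <;> fin_cases k <;> fin_cases l <;> simp
  have hid : ∀ i j k l : Fin 2, (if i ≠ j ∧ k ≠ l then (if i = k then (1 : ℂ) else 0)
      else if i = k ∧ j = l then 1 else 0) = if i = k ∧ j = l then 1 else 0 := by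
    intro i j k l
    fin_cases i <;> fin_cases j <;> fin_cases k <;> fin_cases l <;> simp
  by_cases h : ∀ d, d ≠ c → d ≠ a → d ≠ b → y d = x d
  · by_cases h1 : y c = x c
    · by_cases h2 : x c = 1
      · rw [if_pos h]
        simp only [hfun, hyx, hpair, h1, h2, if_true, hflip, Matrix.cons_val, true_and,
          and_true, eq_true h]
        exact hswap _ _ _ _
      · rw [if_pos h]
        simp only [hyx, hpair, h1, h2, if_false, hone, true_and, and_true, eq_true h, hid]
        simp only [hfun]
        exact if_congr (and_iff_right h1).symm rfl rfl
    · have h2 : ¬ (fun i => y (e i)) = (if x c = 1 then ![x c, x b, x a] else fun i => x (e i)) := by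
        intro h3
        refine h1 ?_
        have h4 := congrFun h3 0
        split_ifs at h4
        · exact h4
        · exact h4
      simp only [hpair, hyx, h1, h2, false_and, and_false, if_false, ite_self]
  · simp only [hpair, hyx, eq_false h, false_and, and_false, if_false]

theorem isWeightPreserving_hat (U : Matrix.unitaryGroup (Fin 2) ℂ) :
    IsWeightPreserving (hat U).op := by
  intro k (x : Bits 2) hx (y : Bits 2) hy
  change weight (n := 2) x = k at hx
  change weight (n := 2) y = k
  change hatOp U.1 y x ≠ 0 at hy
  have hw : ∀ z : Bits 2, z 0 ≠ z 1 → weight z = 1 := by decide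
  simp only [hatOp, Matrix.of_apply] at hy
  split_ifs at hy with h1 h2
  · rw [← hx, hw x h1.2, hw y h1.1]
  · rw [h2, hx]
  · exact absurd rfl hy

theorem isWeightPreserving_fredkin : IsWeightPreserving fredkin.op := by
  intro k (x : Bits 3) hx (y : Bits 3) hy
  change weight (n := 3) x = k at hx
  change weight (n := 3) y = k
  have hw : ∀ z : Bits 3, weight (if z 0 = 1 then ![z 0, z 2, z 1] else z) = weight z := by decide
  change (if y = (if x 0 = 1 then ![x 0, x 2, x 1] else x) then (1 : ℂ) else 0) ≠ 0 at hy
  have h : y = if x 0 = 1 then ![x 0, x 2, x 1] else x := by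
    by_contra h
    exact hy (if_neg h)
  rw [h, hw, hx]

theorem isWeightPreserving_phaseE (δ : ℝ) : IsWeightPreserving (phaseE δ).op := by
  intro k (x : Bits 1) hx (y : Bits 1) hy
  change Matrix.diagonal _ (y 0) (x 0) ≠ 0 at hy
  have h : y 0 = x 0 := by
    by_contra h
    exact hy (Matrix.diagonal_apply_ne _ h)
  have : y = x := funext fun i => by rw [Subsingleton.elim i 0, h]
  rw [this]
  exact hx

end Gates

/-! ### Consequences of universality on one qubit. -/

section Universal

/-- The matrix of `single A`. -/
def singleOp (A : Matrix.unitaryGroup (Fin 2) ℂ) : Op 1 :=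
  Matrix.of fun y x => A.1 (y 0) (x 0)

theorem singleOp_mul (A B : Matrix.unitaryGroup (Fin 2) ℂ) :
    singleOp (A * B) = singleOp A * singleOp B := by
  ext y x
  change (A.1 * B.1) (y 0) (x 0) = ∑ z : Bits 1, A.1 (y 0) (z 0) * B.1 (z 0) (x 0)
  rw [← (Equiv.funUnique (Fin 1) (Fin 2)).symm.sum_comp, Matrix.mul_apply]
  rfl

theorem singleOp_one : singleOp 1 = 1 := by
  ext y x
  have hyz : y = x ↔ y 0 = x 0 :=
    ⟨fun h => h ▸ rfl, fun h => funext fun i => by rw [Subsingleton.elim i 0]; exact h⟩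
  change (1 : Matrix (Fin 2) (Fin 2) ℂ) (y 0) (x 0) = (1 : Op 1) y x
  simp only [Matrix.one_apply, hyz]

variable {s : ℕ} {U : Fin s → Matrix.unitaryGroup (Fin 2) ℂ}

/-- CNOT needs two distinct qubits and so cannot occur on a single one; one-qubit circuits are words
in the `U i`. -/
theorem exists_single_of_mem_circuits {S : Subgroup (Matrix.unitaryGroup (Fin 2) ℂ)}
    (hUS : ∀ i, U i ∈ S) {C : Op 1}
    (hC : C ∈ circuits (Set.range (fun i => single (U i)) ∪ {cnot}) 1) :
    ∃ A ∈ S, C = singleOp A := by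
  induction hC using Submonoid.closure_induction with
  | mem C hC =>
    obtain ⟨g, ⟨i, rfl⟩ | rfl, e, rfl⟩ := hC
    · refine ⟨U i, hUS i, ?_⟩
      change Fin 1 ↪ Fin 1 at e
      ext y x
      change (if ∀ j, (∀ i, e i ≠ j) → y j = x j then (U i).1 (y (e 0)) (x (e 0)) else 0) =
        (U i).1 (y 0) (x 0)
      rw [if_pos fun j hj => absurd (Subsingleton.elim _ _) (hj 0), Subsingleton.elim (e 0) 0]
    · change Fin 2 ↪ Fin 1 at e
      exact absurd (e.injective (Subsingleton.elim (e 0) (e 1))) (by decide)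
  | one => exact ⟨1, S.one_mem, singleOp_one.symm⟩
  | mul C D _ _ hC hD =>
    obtain ⟨A, hA, rfl⟩ := hC
    obtain ⟨B, hB, rfl⟩ := hD
    exact ⟨A * B, S.mul_mem hA hB, (singleOp_mul A B).symm⟩

/-- A closed subgroup of `U(2)` containing single-qubit gates which are universal together with
`CNOT` contains every unitary up to a phase. -/
theorem exists_smul_mem_of_isUniversal
    (hU : IsUniversal (Set.range (fun i => single (U i)) ∪ {cnot}))
    {S : Subgroup (Matrix.unitaryGroup (Fin 2) ℂ)}
    (hS : IsClosed (S : Set (Matrix.unitaryGroup (Fin 2) ℂ))) (hUS : ∀ i, U i ∈ S)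
    (V : Matrix.unitaryGroup (Fin 2) ℂ) :
    ∃ A ∈ S, ∃ c : ℂ, ‖c‖ = 1 ∧ A.1 = c • V.1 := by
  have : CompactSpace (Matrix.unitaryGroup (Fin 2) ℂ) :=
    isCompact_iff_compactSpace.1 isCompact_unitaryGroup
  -- By compactness the distance from `S` to the phase multiples of `V` is attained; universality
  -- makes it zero.
  obtain ⟨⟨A, c⟩, ⟨hA, hc⟩, hmin⟩ :=
    (hS.isCompact.prod (isCompact_sphere (0 : ℂ) 1)).exists_isMinOn
    ⟨(1, 1), S.one_mem, by simp⟩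
    (f := fun p : Matrix.unitaryGroup (Fin 2) ℂ × ℂ =>
      ∑ i, ∑ j, ‖p.1.1 i j - p.2 * V.1 i j‖)
    (by
      refine Continuous.continuousOn (continuous_finsetSum _ fun i _ => continuous_finsetSum _
        fun j _ => (Continuous.sub ?_ (continuous_snd.mul continuous_const)).norm)
      exact (continuous_subtype_val.comp continuous_fst).matrix_elem i j)
  refine ⟨A, hA, c, by simpa using hc, ?_⟩
  have hle : (∑ i, ∑ j, ‖A.1 i j - c * V.1 i j‖) ≤ 0 := by
    refine le_of_forall_pos_le_add fun ε hε => ?_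
    obtain ⟨C, hC, d, hd, hCd⟩ := hU 1 (single V).op (single V).unitary (ε / 4) (by positivity)
    obtain ⟨B, hB, rfl⟩ := exists_single_of_mem_circuits hUS hC
    refine (hmin (a := (B, d)) ⟨hB, by simpa using hd⟩).trans ?_
    -- Evaluating on basis vectors bounds each of the four entries, whence the accuracy `ε / 4`.
    have hent : ∀ i j, ‖B.1 i j - d * V.1 i j‖ ≤ ε / 4 := by
      intro i j
      have h := hCd (EuclideanSpace.single (fun _ => j) 1)
      have h' := (PiLp.norm_apply_le _ (fun _ => i)).trans h
      simpa [Matrix.toLpLin_apply, single, singleOp] using h'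
    simp only [Fin.sum_univ_two]
    linarith [hent 0 0, hent 0 1, hent 1 0, hent 1 1]
  have h0 : ∀ i j, ‖A.1 i j - c * V.1 i j‖ = 0 := by
    simp only [Fin.sum_univ_two] at hle
    have := fun i j => norm_nonneg (A.1 i j - c * V.1 i j)
    intro i j
    refine le_antisymm ?_ (this i j)
    fin_cases i <;> fin_cases j <;> simp only [Fin.zero_eta, Fin.mk_one] <;>
      linarith [this 0 0, this 0 1, this 1 0, this 1 1]
  ext i j
  simpa [sub_eq_zero] using h0 i j

/-- A rotation is a commutator, and a commutator does not change when its two arguments are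
multiplied by phases. -/
theorem rotations_subset_of_isUniversal
    (hU : IsUniversal (Set.range (fun i => single (U i)) ∪ {cnot}))
    {S : Subgroup (Matrix.unitaryGroup (Fin 2) ℂ)}
    (hS : IsClosed (S : Set (Matrix.unitaryGroup (Fin 2) ℂ))) (hUS : ∀ i, U i ∈ S) :
    rotations ⊆ S := by
  intro A hA
  obtain ⟨V, -, W, -, rfl⟩ := exists_commutator_eq hA
  obtain ⟨B, hB, c, hc, hBV⟩ := exists_smul_mem_of_isUniversal hU hS hUS V
  obtain ⟨C, hC, d, hd, hCW⟩ := exists_smul_mem_of_isUniversal hU hS hUS W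
  have hcc : c * star c = 1 := by
    rw [Complex.star_def, Complex.mul_conj, Complex.normSq_eq_norm_sq, hc]; simp
  have hdd : d * star d = 1 := by
    rw [Complex.star_def, Complex.mul_conj, Complex.normSq_eq_norm_sq, hd]; simp
  have h : B * C * B⁻¹ * C⁻¹ = V * W * V⁻¹ * W⁻¹ := by
    refine Subtype.ext ?_
    change B.1 * C.1 * star B.1 * star C.1 = V.1 * W.1 * star V.1 * star W.1
    rw [hBV, hCW, star_smul, star_smul]
    simp only [Matrix.smul_mul, Matrix.mul_smul, smul_smul]
    have : star d * (star c * (d * c)) = 1 := by linear_combination hcc * d * star d + hdd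
    convert one_smul ℂ _ using 2
  rw [← h]
  exact S.mul_mem (S.mul_mem (S.mul_mem hB hC) (S.inv_mem hB)) (S.inv_mem hC)

end Universal

/-! ### Implementing operators with ancillas. -/

section Ancilla

variable {n m : ℕ}

/-- The isometry `|x⟩ ↦ |x⟩ ⊗ |a⟩`. -/
def ancillaMatrix (n : ℕ) {m : ℕ} (a : Bits m) : Matrix (Bits (n + m)) (Bits n) ℂ :=
  Matrix.of fun y x =>
    if (fun j => y (Fin.natAdd n j)) = a then (1 : Op n) (fun i => y (Fin.castAdd m i)) x else 0

theorem withAncilla_eq (a : Bits m) (ψ : State n) :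
    withAncilla a ψ = Matrix.toEuclideanLin (ancillaMatrix n a) ψ := by
  rw [Matrix.toLpLin_apply, withAncilla]
  congr 1
  funext y
  simp only [Matrix.mulVec, dotProduct, ancillaMatrix, Matrix.of_apply, Matrix.one_apply]
  split_ifs <;> simp

theorem ancillaMatrix_mul_apply {κ : Type*} (a : Bits m) (B : Matrix (Bits n) κ ℂ)
    (y : Bits (n + m)) (x : κ) :
    (ancillaMatrix n a * B) y x =
      if (fun j => y (Fin.natAdd n j)) = a then B (fun i => y (Fin.castAdd m i)) x else 0 := by
  rw [Matrix.mul_apply]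
  simp only [ancillaMatrix, Matrix.of_apply]
  split_ifs
  · rw [← Matrix.mul_apply, Matrix.one_mul]
  · simp

theorem ancillaMatrix_mul_append_apply {κ : Type*} (a b : Bits m) (B : Matrix (Bits n) κ ℂ)
    (x : Bits n) (z : κ) :
    (ancillaMatrix n a * B) (Fin.append x b) z = if b = a then B x z else 0 := by
  simp only [ancillaMatrix_mul_apply, Fin.append_left, Fin.append_right]

theorem ancillaMatrix_append_apply (a b : Bits m) (x z : Bits n) :
    ancillaMatrix n a (Fin.append x b) z = if b = a then (1 : Op n) x z else 0 := by
  rw [← ancillaMatrix_mul_append_apply, Matrix.mul_one]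

theorem exists_append_eq (z : Bits (n + m)) : ∃ x b, Fin.append x b = z :=
  ⟨_, _, Fin.append_castAdd_natAdd⟩

theorem weight_append (x : Bits n) (b : Bits m) :
    weight (Fin.append x b) = weight x + weight b := by
  simp only [weight, Finset.card_filter, Fin.sum_univ_add, Fin.append_left, Fin.append_right]

theorem append_injective2 {x y : Bits n} {a b : Bits m} :
    Fin.append x a = Fin.append y b ↔ x = y ∧ a = b := by
  constructor
  · intro h
    refine ⟨funext fun i => ?_, funext fun i => ?_⟩
    · simpa using congrFun h (Fin.castAdd m i)
    · simpa using congrFun h (Fin.natAdd n i)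
  · rintro ⟨rfl, rfl⟩; rfl

theorem twoLevel_mul_ancillaMatrix (a : Bits m) (x y : Bits n) (A : Matrix (Fin 2) (Fin 2) ℂ) :
    twoLevel (Fin.append x a) (Fin.append y a) A * ancillaMatrix n a =
      ancillaMatrix n a * twoLevel x y A := by
  ext z w
  obtain ⟨z, b, rfl⟩ := exists_append_eq z
  rw [twoLevel_mul_apply, ancillaMatrix_mul_append_apply]
  simp only [ancillaMatrix_append_apply, append_injective2, twoLevel, Matrix.of_apply]
  by_cases h : b = a <;> simp [h]

/-- The compensating phase `e^{-iθ}` sits on `|x⟩|b⟩`, which is orthogonal to all states with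
ancilla `a`. -/
theorem phase_mul_ancillaMatrix {a b : Bits m} (hab : a ≠ b) (x : Bits n) (θ : ℝ) :
    twoLevel (Fin.append x a) (Fin.append x b) (phaseU θ).1 * ancillaMatrix n a =
      ancillaMatrix n a *
        Matrix.diagonal (Pi.mulSingle x (Complex.exp (θ * Complex.I))) := by
  ext z w
  obtain ⟨z, c, rfl⟩ := exists_append_eq z
  rw [twoLevel_mul_apply, ancillaMatrix_mul_append_apply]
  simp only [ancillaMatrix_append_apply, append_injective2, phaseU, Matrix.diagonal_apply,
    Matrix.one_apply]
  by_cases hc : c = a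
  · subst hc
    by_cases hz : z = x
    · subst hz; simp [hab.symm]
    · simp [hz]
  · by_cases hc' : c = b
    · simp [hc', hab.symm]
    · simp [hc, hc']

theorem ancillaMatrix_eq (a : Bits m) (y : Bits (n + m)) (x : Bits n) :
    ancillaMatrix n a y x = if y = Fin.append x a then 1 else 0 := by
  obtain ⟨y, b, rfl⟩ := exists_append_eq y
  simp only [ancillaMatrix_append_apply, append_injective2, Matrix.one_apply]
  by_cases h : b = a <;> simp [h]

theorem conjTranspose_ancillaMatrix_mul_self (a : Bits m) :
    (ancillaMatrix n a).conjTranspose * ancillaMatrix n a = 1 := by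
  ext x z
  rw [Matrix.mul_apply]
  simp [Matrix.conjTranspose_apply, ancillaMatrix_eq, append_injective2, Matrix.one_apply,
    eq_comm]

/-- The operators `V` on `n` qubits for which an element of `M` maps `|ψ⟩|a⟩` to `(V|ψ⟩)|a⟩`. -/
def implementable (M : Submonoid (Op (n + m))) (a : Bits m) : Submonoid (Op n) where
  carrier := {V | ∃ h ∈ M, h * ancillaMatrix n a = ancillaMatrix n a * V}
  one_mem' := ⟨1, M.one_mem, by rw [Matrix.one_mul, Matrix.mul_one]⟩
  mul_mem' := by
    rintro V W ⟨g, hg, hgV⟩ ⟨h, hh, hhW⟩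
    refine ⟨g * h, mul_mem hg hh, ?_⟩
    rw [Matrix.mul_assoc, hhW, ← Matrix.mul_assoc, hgV, Matrix.mul_assoc]

theorem implementable_le {M : Submonoid (Op (n + m))}
    (hM : M ≤ Matrix.unitaryGroup (Bits (n + m)) ℂ) (a : Bits m) :
    implementable M a ≤ Matrix.unitaryGroup (Bits n) ℂ := by
  rintro V ⟨h, hh, e⟩
  have h1 : h.conjTranspose * h = 1 := Matrix.mem_unitaryGroup_iff'.1 (hM hh)
  have e1 := conjTranspose_ancillaMatrix_mul_self (n := n) a
  rw [Matrix.mem_unitaryGroup_iff', Matrix.star_eq_conjTranspose]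
  calc V.conjTranspose * V
      = (ancillaMatrix n a * V).conjTranspose * (ancillaMatrix n a * V) := by
        rw [Matrix.conjTranspose_mul, Matrix.mul_assoc, ← Matrix.mul_assoc _ _ V, e1,
          Matrix.one_mul]
    _ = 1 := by
        rw [← e, Matrix.conjTranspose_mul, Matrix.mul_assoc, ← Matrix.mul_assoc _ h, h1,
          Matrix.one_mul, e1]

/-- The set is the projection of a compact set of pairs `(V, h)`; compactness of `M` keeps the
witnesses `h` from being lost in the limit. -/
theorem isClosed_implementable {M : Submonoid (Op (n + m))}
    (hMu : M ≤ Matrix.unitaryGroup (Bits (n + m)) ℂ) (hMc : IsClosed (M : Set (Op (n + m))))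
    (a : Bits m) : IsClosed (implementable M a : Set (Op n)) := by
  have h : (implementable M a : Set (Op n)) = Prod.fst ''
      (((Matrix.unitaryGroup (Bits n) ℂ : Set (Op n)) ×ˢ (M : Set (Op (n + m)))) ∩
        {p | p.2 * ancillaMatrix n a = ancillaMatrix n a * p.1}) := by
    ext V
    constructor
    · rintro ⟨h, hh, e⟩
      exact ⟨(V, h), ⟨⟨implementable_le hMu a ⟨h, hh, e⟩, hh⟩, e⟩, rfl⟩
    · rintro ⟨⟨V, h⟩, ⟨⟨hV, hh⟩, e⟩, rfl⟩
      exact ⟨h, hh, e⟩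
  rw [h]
  refine (IsCompact.image ?_ continuous_fst).isClosed
  refine (isCompact_unitaryGroup.prod
    (isCompact_unitaryGroup.of_isClosed_subset hMc hMu)).inter_right (isClosed_eq ?_ ?_)
  · exact Continuous.matrix_mul continuous_snd continuous_const
  · exact Continuous.matrix_mul continuous_const continuous_fst

/-- A compact group of operators containing all rotations in planes spanned by two basis vectors
of the same weight implements all weight-preserving unitaries, if the ancillas can be moved to
another state of the same weight. -/
theorem mem_implementable {M : Submonoid (Op (n + m))}
    (hMu : M ≤ Matrix.unitaryGroup (Bits (n + m)) ℂ) (hMc : IsClosed (M : Set (Op (n + m))))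
    (hT : ∀ (x y : Bits (n + m)), x ≠ y → weight x = weight y → ∀ A ∈ rotations,
      twoLevel x y A.1 ∈ M)
    {a b : Bits m} (hab : a ≠ b) (hw : weight a = weight b) {V : Op n}
    (hV : V ∈ Matrix.unitaryGroup (Bits n) ℂ) (hVw : IsWeightPreserving V) :
    V ∈ implementable M a := by
  refine mem_of_twoLevel_mem (implementable_le hMu a) (isClosed_implementable hMu hMc a) weight
    (fun x y hxy hxyw t φ => ⟨_, ?_, twoLevel_mul_ancillaMatrix a x y _⟩)
    (fun d hd => ?_) hV fun x y hne => ?_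
  · exact hT (Fin.append x a) (Fin.append y a) (fun h => hxy (append_injective2.1 h).1)
      (by rw [weight_append, weight_append, hxyw]) (rotU t φ) (rotU_mem t φ)
  · have hphase : ∀ x, Matrix.diagonal (Pi.mulSingle x (d x)) ∈ implementable M a := by
      intro x
      have hdx : d x = Complex.exp (Complex.arg (d x) * Complex.I) := by
        have := Complex.norm_mul_exp_arg_mul_I (d x)
        rw [hd x, Complex.ofReal_one, one_mul] at this
        exact this.symm
      rw [hdx]
      exact ⟨_, hT (Fin.append x a) (Fin.append x b) (fun h => hab (append_injective2.1 h).2)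
        (by rw [weight_append, weight_append, hw]) (phaseU _) (phaseU_mem _),
        phase_mul_ancillaMatrix hab x _⟩
    have hmem : d ∈ (implementable M a).comap
        (Matrix.diagonalRingHom (Bits n) ℂ : (Bits n → ℂ) →* Op n) := by
      rw [← Finset.univ_prod_mulSingle d]
      exact Submonoid.prod_mem _ fun x _ => hphase x
    exact hmem
  · by_contra h0
    exact hne (hVw _ x rfl y h0)

end Ancilla

/-! ### From the closure back to circuits. -/

section Main

/-- The closure of the unitary circuits over `G`. -/
def circuitClosure (G : Set Gate) (n : ℕ) : Submonoid (Op n) :=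
  (circuits G n ⊓ Matrix.unitaryGroup (Bits n) ℂ).topologicalClosure

variable {G : Set Gate} {n m : ℕ}

theorem isClosed_circuitClosure : IsClosed (circuitClosure G n : Set (Op n)) :=
  Submonoid.isClosed_topologicalClosure _

theorem circuitClosure_le : circuitClosure G n ≤ Matrix.unitaryGroup (Bits n) ℂ :=
  Submonoid.topologicalClosure_minimal _ inf_le_right isClosed_unitaryGroup

theorem star_mem_circuitClosure : ∀ u ∈ circuitClosure G n, star u ∈ circuitClosure G n :=
  fun _ => star_mem_of_isClosed circuitClosure_le isClosed_circuitClosure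

theorem on_mem_circuitClosure {g : Gate} (hg : g ∈ G) (e : Fin g.arity ↪ Fin n)
    (hu : g.on e ∈ Matrix.unitaryGroup (Bits n) ℂ) : g.on e ∈ circuitClosure G n :=
  Submonoid.le_topologicalClosure _ ⟨Submonoid.subset_closure ⟨g, hg, e, rfl⟩, hu⟩

theorem exists_circuit_of_mem_implementable {a : Bits m} {V : Op n}
    (hV : V ∈ implementable (circuitClosure G (n + m)) a) {ε : ℝ} (hε : 0 < ε) :
    ∃ C ∈ circuits G (n + m), ∀ ψ : State n,
      ‖Matrix.toEuclideanLin C (withAncilla a ψ) -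
        withAncilla a (Matrix.toEuclideanLin V ψ)‖ ≤ ε * ‖ψ‖ := by
  obtain ⟨h, hh, e⟩ := hV
  -- Measuring the error in operator norm makes it uniform in `ψ`. It is continuous in the matrix
  -- and vanishes at `h`, so a circuit close to `h` has error below `ε`.
  let Φ : Matrix (Bits (n + m)) (Bits n) ℂ →ₗ[ℂ] (State n →L[ℂ] State (n + m)) :=
    LinearMap.toContinuousLinearMap.toLinearMap ∘ₗ Matrix.toEuclideanLin.toLinearMap
  have hΦ : Continuous Φ := Φ.continuous_of_finiteDimensional
  have hc : Continuous fun C : Op (n + m) => ‖Φ (C * ancillaMatrix n a - ancillaMatrix n a * V)‖ :=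
    (hΦ.comp ((continuous_id.matrix_mul continuous_const).sub continuous_const)).norm
  have hopen : IsOpen {C : Op (n + m) | ‖Φ (C * ancillaMatrix n a - ancillaMatrix n a * V)‖ < ε} :=
    isOpen_lt hc continuous_const
  obtain ⟨C, hC, hC'⟩ := mem_closure_iff.1 hh _ hopen (by simpa [e] using hε)
  refine ⟨C, hC'.1, fun ψ => ?_⟩
  have hψ : Matrix.toEuclideanLin C (withAncilla a ψ) - withAncilla a (Matrix.toEuclideanLin V ψ) =
      Φ (C * ancillaMatrix n a - ancillaMatrix n a * V) ψ := by
    simp only [withAncilla_eq, Φ, LinearMap.comp_apply, LinearEquiv.coe_coe,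
      LinearMap.coe_toContinuousLinearMap', Matrix.toLpLin_apply, Matrix.sub_mulVec,
      ← Matrix.mulVec_mulVec, WithLp.toLp_sub]
  rw [hψ]
  exact (ContinuousLinearMap.le_opNorm _ _).trans
    (mul_le_mul_of_nonneg_right (le_of_lt hC) (norm_nonneg _))

/-- The unitaries whose `hat` on the qubits `a, b` belongs to `M`. -/
def hatSubgroup (M : Submonoid (Op n)) (hM : ∀ u ∈ M, star u ∈ M) {a b : Fin n} (hab : a ≠ b) :
    Subgroup (Matrix.unitaryGroup (Fin 2) ℂ) :=
  (pairSubgroup M hM hab).comap (Pi.constMonoidHom _ _)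

theorem isClosed_hatSubgroup {M : Submonoid (Op n)} {hM : ∀ u ∈ M, star u ∈ M}
    (hMc : IsClosed (M : Set (Op n))) {a b : Fin n} (hab : a ≠ b) :
    IsClosed (hatSubgroup M hM hab : Set (Matrix.unitaryGroup (Fin 2) ℂ)) := by
  refine hMc.preimage (f := fun A : Matrix.unitaryGroup (Fin 2) ℂ => pairHom hab fun _ => A) ?_
  refine continuous_matrix fun y x => ?_
  simp only [pairHom_apply, pairMatrix, Matrix.of_apply]
  split_ifs
  · exact continuous_finsetSum _ fun i _ =>
      (continuous_subtype_val.matrix_elem _ _).mul continuous_const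
  · exact continuous_const

end Main

end WeightCircuit

end

theorem mainTheorem9 (s : ℕ) (U : Fin s → Matrix.unitaryGroup (Fin 2) ℂ) (δ : ℝ)
    (hU : WeightCircuit.IsUniversal
      (Set.range (fun i => WeightCircuit.single (U i)) ∪ {WeightCircuit.cnot})) :
    WeightCircuit.IsWeightUniversal
      (Set.range (fun i => WeightCircuit.hat (U i)) ∪
        {WeightCircuit.fredkin, WeightCircuit.phaseE δ})
      (![0, 1] : WeightCircuit.Bits 2) := by
  open WeightCircuit in
  refine ⟨?_, fun n V hV hVw ε hε => exists_circuit_of_mem_implementable ?_ hε⟩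
  · rintro g (⟨i, rfl⟩ | rfl | rfl)
    · exact isWeightPreserving_hat _
    · exact isWeightPreserving_fredkin
    · exact isWeightPreserving_phaseE δ
  · refine mem_implementable circuitClosure_le isClosed_circuitClosure
      (twoLevel_mem star_mem_circuitClosure (fun a b hab A hA => ?_) fun a b c hab hca hcb => ?_)
      -- The ancilla state `10` has the same weight as `01` and absorbs the compensating phases.
      (b := ![1, 0]) (by decide) (by decide) hV hVw
    · refine rotations_subset_of_isUniversal hU (S := hatSubgroup _ star_mem_circuitClosure hab)
        (isClosed_hatSubgroup isClosed_circuitClosure hab) (fun i => ?_) hA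
      change pairHom hab (fun _ => U i) ∈ circuitClosure _ _
      obtain ⟨e, he⟩ := exists_hat_on_eq (U i) hab
      -- Unitarity of the placed gate is read off from its form as a pair operator.
      have hu := pairHom_mem_unitaryGroup hab fun _ => U i
      rw [he] at hu ⊢
      exact on_mem_circuitClosure (Or.inl ⟨i, rfl⟩) e hu
    · obtain ⟨e, he⟩ := exists_fredkin_on_eq hab hca hcb
      have hu := pairHom_mem_unitaryGroup hab fun p => if p c = 1 then flipU else 1
      rw [he] at hu ⊢
      exact on_mem_circuitClosure (Or.inr (Or.inl rfl)) e hu
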